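/- Let $I_1,I_2,I_3\subseteq\mathbb R$ be nonempty open intervals (possibly unbounded), $I=I_1\times I_2\times I_3$ with standard coordinates $(x^1,x^2,x^3)$, and let $f_1=f_1(x^3)$ and $f_2=f_2(x^3)$ be smooth nowhere zero functions on $I_3$, and $f_3=f_3(x^1)$ a smooth nowhere zero function on $I_1$. Consider on $I$ the Riemannian metric $$g=\frac{1}{f_1^2}(dx^1)^2+\frac{1}{f_2^2}(dx^2)^2+\frac{1}{f_3^2}(dx^3)^2 .$$ Then $(I,g)$ is flat (i.e. the Riemann curvature tensor of its Levi-Civita connection vanishes identically) if and only if one of the following assertions holds: (1) $f_1=k_1$, $f_2=k_2$, $f_3=k_3$ with constants $k_1,k_2,k_3\in\mathbb R\setminus\{0\}$; (2) $f_1(x^3)=\frac{k_1}{x^3-c_1}$, $f_2=k_2$, $f_3=k_3$, with $k_1,k_2,k_3\in\mathbb R\setminus\{0\}$, $c_1\in\mathbb R\setminus I_3$; (3) $f_1=k_1$, $f_2(x^3)=\frac{k_2}{x^3-c_2}$, $f_3=k_3$, with $k_1,k_2,k_3\in\mathbb R\setminus\{0\}$, $c_2\in\mathbb R\setminus I_3$;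 (4) $f_1=k_1$, $f_2=k_2$, $f_3(x^1)=\frac{k_3}{x^1-c_3}$, with $k_1,k_2,k_3\in\mathbb R\setminus\{0\}$, $c_3\in\mathbb R\setminus I_1$; (5) $f_1(x^3)=\frac{k_1}{x^3-c_1}$, $f_2=k_2$, $f_3(x^1)=\frac{k_3}{x^1-c_3}$, with $k_1,k_2,k_3\in\mathbb R\setminus\{0\}$, $c_1\in\mathbb R\setminus I_3$, $c_3\in\mathbb R\setminus I_1$; (6) $f_2$ is a nonzero constant, and there are $k_1,k_3\in\mathbb R\setminus\{0\}$ with $k_3=-k_1$ such that, for each $(i,j)\in\{(1,3),(3,1)\}$, there are $r_i\in\mathbb R$, a maximal connected subset $D_i$ of $\{z\in\mathbb R\setminus\{0\} : -2k_i\ln|z|+r_i>0\}$ and an antiderivative $F_i$ on $D_i$ of $$z\mapsto \frac{1}{\sqrt{-2k_i\ln|z|+r_i}},$$ with inverse $F_i^{-1}:F_i(D_i)\to D_i$, for which one of the following two alternatives holds: (6a) there are $\eta_i\in\{\pm1\}$ and $d_i\in\mathbb R$ such that, for every $x^j\in I_j$, $\eta_ix^j+d_i\in F_i(D_i)$ and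 $f_i(x^j)=\frac{1}{F_i^{-1}(\eta_i x^j+d_i)}$; (6b) there are $z_0^i\in\partial D_i\setminus\{0\}$ and $x_0^j\in I_j$ such that, with $\varepsilon_i:=\operatorname{sign}(-k_iz_0^i)$ and $c_i:=\lim_{z\to z_0^i,\,z\in D_i}F_i(z)-\varepsilon_ix_0^j$, for every $x^j\in I_j$, $$f_i(x^j)=\begin{cases}\dfrac{1}{F_i^{-1}(-\varepsilon_i x^j+2\varepsilon_i x_0^j+c_i)} & \text{for } x^j<x_0^j,\\[2ex] \dfrac{1}{\lim_{t\searrow x_0^j}F_i^{-1}(\varepsilon_i t+c_i)} & \text{for } x^j=x_0^j,\\[2ex] \dfrac{1}{F_i^{-1}(\varepsilon_i x^j+c_i)} & \text{for } x^j>x_0^j,\end{cases}$$ where all arguments of $F_i^{-1}$ for $x^j\in I_j\setminus\{x_0^j\}$ lie in $F_i(D_i)$ and both limits exist. -/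

import Mathlib

open Set Filter Topology
open scoped ContDiff

noncomputable section

namespace DiagonalMetric

/-- The partial derivative `∂f/∂xⁱ` at `x`. -/
def partialDeriv {n : ℕ} (i : Fin n) (f : (Fin n → ℝ) → ℝ) (x : Fin n → ℝ) : ℝ :=
  deriv (fun t => f (Function.update x i t)) (x i)

/-- The Christoffel symbol `Γᵏᵢⱼ` of the Levi-Civita connection of the metric with coefficient
matrix `G`, so that `∇_{∂ᵢ} ∂ⱼ = ∑ₖ Γᵏᵢⱼ ∂ₖ`. -/
def christoffel {n : ℕ} (G : (Fin n → ℝ) → Matrix (Fin n) (Fin n) ℝ) (k i j : Fin n)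
    (x : Fin n → ℝ) : ℝ :=
  (1 / 2) * ∑ l, (G x)⁻¹ k l *
    (partialDeriv i (fun y => G y j l) x + partialDeriv j (fun y => G y i l) x
      - partialDeriv l (fun y => G y i j) x)

/-- The component along `∂ₗ` of
`R(∂ᵢ, ∂ⱼ) ∂ₖ = ∇_{∂ᵢ} ∇_{∂ⱼ} ∂ₖ - ∇_{∂ⱼ} ∇_{∂ᵢ} ∂ₖ`
(coordinate fields commute), where `∇` is the Levi-Civita connection of `G`. -/
def riemann {n : ℕ} (G : (Fin n → ℝ) → Matrix (Fin n) (Fin n) ℝ) (l i j k : Fin n)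
    (x : Fin n → ℝ) : ℝ :=
  partialDeriv i (christoffel G l j k) x - partialDeriv j (christoffel G l i k) x
    + ∑ m, (christoffel G l i m x * christoffel G m j k x
      - christoffel G l j m x * christoffel G m i k x)

/-- The metric with coefficient matrix `G` is flat on `U`: its Riemann tensor vanishes there. -/
def IsFlatOn {n : ℕ} (G : (Fin n → ℝ) → Matrix (Fin n) (Fin n) ℝ)
    (U : Set (Fin n → ℝ)) : Prop :=
  ∀ x ∈ U, ∀ l i j k, riemann G l i j k x = 0

/-- The coefficient matrix of `∑ᵢ (1 / fᵢ²) (dxⁱ)²`. -/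
def diagMetric {n : ℕ} (f : Fin n → (Fin n → ℝ) → ℝ) (x : Fin n → ℝ) :
    Matrix (Fin n) (Fin n) ℝ :=
  Matrix.diagonal fun i => 1 / f i x ^ 2

/-- The box `I₁ × I₂ × I₃`; the coordinates `x¹, x², x³` are `x 0, x 1, x 2`. -/
def box (I₁ I₂ I₃ : Set ℝ) : Set (Fin 3 → ℝ) :=
  {x | x 0 ∈ I₁ ∧ x 1 ∈ I₂ ∧ x 2 ∈ I₃}

/-- A nonempty open interval of the real line, possibly unbounded. -/
def IsOpenInterval (I : Set ℝ) : Prop :=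
  IsOpen I ∧ I.OrdConnected ∧ I.Nonempty

/-- `f` is a nonzero constant on `I`. -/
def IsConstOn (f : ℝ → ℝ) (I : Set ℝ) : Prop :=
  ∃ k : ℝ, k ≠ 0 ∧ ∀ t ∈ I, f t = k

/-- `f(t) = k / (t - c)` on `I`, with `k ≠ 0` and `c ∉ I`. -/
def IsReciprocalOn (f : ℝ → ℝ) (I : Set ℝ) : Prop :=
  ∃ k c : ℝ, k ≠ 0 ∧ c ∉ I ∧ ∀ t ∈ I, f t = k / (t - c)

/-- `D` is a maximal connected subset of `ℝ \ {0}` on which the function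
`z ↦ 1 / √(-2 k ln |z| + r)` is defined. -/
def IsMaximalDomain (k r : ℝ) (D : Set ℝ) : Prop :=
  Maximal (fun S : Set ℝ => IsConnected S ∧
    S ⊆ {z | z ≠ 0 ∧ 0 < -2 * k * Real.log |z| + r}) D

/-- `F` is an antiderivative of `z ↦ 1 / √(-2 k ln |z| + r)` on `D`. -/
def IsLogAntideriv (k r : ℝ) (D : Set ℝ) (F : ℝ → ℝ) : Prop :=
  ∀ z ∈ D, HasDerivAt F (1 / √(-2 * k * Real.log |z| + r)) z

/-- `f(x) = 1 / F⁻¹(η x + d)` on `I`, where `η = ±1` and `η x + d ∈ F(D)` for all `x ∈ I`. Here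
`F⁻¹` is the inverse of the restriction of `F` to `D`. -/
def IsMonotoneForm (D : Set ℝ) (F : ℝ → ℝ) (I : Set ℝ) (f : ℝ → ℝ) : Prop :=
  ∃ η d : ℝ, (η = 1 ∨ η = -1) ∧
    ∀ x ∈ I, η * x + d ∈ F '' D ∧ f x = 1 / Function.invFunOn F D (η * x + d)

/-- The solution glued at `x₀`: with `z₀ ∈ ∂D \ {0}`, `ε = sign (-k z₀)` and
`c = lim_{z → z₀} F(z) - ε x₀`, the function `f` is `1 / F⁻¹(-ε x + 2 ε x₀ + c)` to the left of
`x₀`, `1 / lim_{t ↘ x₀} F⁻¹(ε t + c)` at `x₀`, and `1 / F⁻¹(ε x + c)` to the right of `x₀`.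
The arguments of `F⁻¹` are required to lie in its domain `F(D)`, and the limits to exist. -/
def IsGluedForm (k : ℝ) (D : Set ℝ) (F : ℝ → ℝ) (I : Set ℝ) (f : ℝ → ℝ) : Prop :=
  ∃ z₀ ∈ frontier D \ {0}, ∃ x₀ ∈ I, ∃ ε c L ℓ : ℝ,
    ε = Real.sign (-k * z₀) ∧
    Tendsto F (𝓝[D] z₀) (𝓝 L) ∧ c = L - ε * x₀ ∧
    Tendsto (fun t => Function.invFunOn F D (ε * t + c)) (𝓝[>] x₀) (𝓝 ℓ) ∧
    (∀ x ∈ I, x < x₀ → -ε * x + 2 * ε * x₀ + c ∈ F '' D ∧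
      f x = 1 / Function.invFunOn F D (-ε * x + 2 * ε * x₀ + c)) ∧
    f x₀ = 1 / ℓ ∧
    (∀ x ∈ I, x₀ < x → ε * x + c ∈ F '' D ∧
      f x = 1 / Function.invFunOn F D (ε * x + c))

/-- `f` has, on `I`, one of the two explicit forms attached to the constant `k`, for some `r`, some
maximal domain `D` and some antiderivative `F`. -/
def IsLogForm (k : ℝ) (I : Set ℝ) (f : ℝ → ℝ) : Prop :=
  ∃ (r : ℝ) (D : Set ℝ) (F : ℝ → ℝ), IsMaximalDomain k r D ∧ IsLogAntideriv k r D F ∧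
    (IsMonotoneForm D F I f ∨ IsGluedForm k D F I f)

end DiagonalMetric

end

/-! Put u = 1/f₁, v = 1/f₂, w = 1/f₃. Flatness is equivalent to the Lamé equations v'' = 0, u'v' =
0, v'w' = 0, uu'' + ww'' = 0 (`isFlatOn_lameMetric_iff`). If v' is somewhere nonzero, it is a
nonzero constant, so u and w are constant. Otherwise v is constant and separation of variables gives
uu'' = -k and ww'' = k. For k = 0 both functions are affine, which yields the constant and
reciprocal forms.

For k ≠ 0 the equation uu'' = -k has the first integral u'² = -2k ln|u| + r (`exists_sq_deriv_eq`),
and a quadrature gives F(u) = ±x + d wherever u' ≠ 0. As u'' = -k/u keeps its sign, u' vanishes at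
most once: never in the monotone form, and at the turning point x₀ in the glued form, where two
branches of F⁻¹ meet (`isLogForm_of_mul_deriv_deriv_eq`). Conversely, differentiating F(u) = ±x + d
twice recovers the equation (`mul_deriv_deriv_eq_of_isLogForm`). -/

namespace DiagonalMetric

/-! ### Curvature of the metric and the Lamé equations. -/

section Curvature

/-- The coefficient matrix of `u(x³)² (dx¹)² + v(x³)² (dx²)² + w(x¹)² (dx³)²`. -/
noncomputable def lameMetric (u v w : ℝ → ℝ) (x : Fin 3 → ℝ) : Matrix (Fin 3) (Fin 3) ℝ :=
  Matrix.diagonal ![u (x 2) ^ 2, v (x 2) ^ 2, w (x 0) ^ 2]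

theorem diagMetric_eq_lameMetric (f₁ f₂ f₃ : ℝ → ℝ) :
    diagMetric ![fun x => f₁ (x 2), fun x => f₂ (x 2), fun x => f₃ (x 0)] =
      lameMetric (fun t => (f₁ t)⁻¹) (fun t => (f₂ t)⁻¹) (fun t => (f₃ t)⁻¹) := by
  funext x
  unfold diagMetric lameMetric
  congr 1
  funext i
  fin_cases i <;> simp

/-- The factor depending on `x³` of the Christoffel symbol `Γᵏᵢⱼ` of `lameMetric u v w`. -/
noncomputable def lameFactor₃ (u u' v v' : ℝ → ℝ) (k i j : Fin 3) (t : ℝ) : ℝ :=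
  match k, i, j with
  | 0, 0, 2 => u' t / u t
  | 0, 2, 0 => u' t / u t
  | 2, 0, 0 => -(u t * u' t)
  | 1, 1, 2 => v' t / v t
  | 1, 2, 1 => v' t / v t
  | 2, 1, 1 => -(v t * v' t)
  | 2, 2, 0 => 1
  | 2, 0, 2 => 1
  | 0, 2, 2 => (u t ^ 2)⁻¹
  | _, _, _ => 0

/-- The factor depending on `x¹` of the Christoffel symbol `Γᵏᵢⱼ` of `lameMetric u v w`. -/
noncomputable def lameFactor₁ (w w' : ℝ → ℝ) (k i j : Fin 3) (s : ℝ) : ℝ :=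
  match k, i, j with
  | 0, 0, 2 => 1
  | 0, 2, 0 => 1
  | 2, 0, 0 => (w s ^ 2)⁻¹
  | 1, 1, 2 => 1
  | 1, 2, 1 => 1
  | 2, 1, 1 => (w s ^ 2)⁻¹
  | 2, 2, 0 => w' s / w s
  | 2, 0, 2 => w' s / w s
  | 0, 2, 2 => -(w s * w' s)
  | _, _, _ => 0

/-- The derivative of `lameFactor₃`. -/
noncomputable def lameFactorDeriv₃ (u u' u'' v v' v'' : ℝ → ℝ) (k i j : Fin 3) (t : ℝ) : ℝ :=
  match k, i, j with
  | 0, 0, 2 => (u'' t * u t - u' t * u' t) / u t ^ 2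
  | 0, 2, 0 => (u'' t * u t - u' t * u' t) / u t ^ 2
  | 2, 0, 0 => -(u' t * u' t + u t * u'' t)
  | 1, 1, 2 => (v'' t * v t - v' t * v' t) / v t ^ 2
  | 1, 2, 1 => (v'' t * v t - v' t * v' t) / v t ^ 2
  | 2, 1, 1 => -(v' t * v' t + v t * v'' t)
  | 0, 2, 2 => -(2 * u t * u' t) / (u t ^ 2) ^ 2
  | _, _, _ => 0

/-- The derivative of `lameFactor₁`. -/
noncomputable def lameFactorDeriv₁ (w w' w'' : ℝ → ℝ) (k i j : Fin 3) (s : ℝ) : ℝ :=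
  match k, i, j with
  | 2, 0, 0 => -(2 * w s * w' s) / (w s ^ 2) ^ 2
  | 2, 1, 1 => -(2 * w s * w' s) / (w s ^ 2) ^ 2
  | 2, 2, 0 => (w'' s * w s - w' s * w' s) / w s ^ 2
  | 2, 0, 2 => (w'' s * w s - w' s * w' s) / w s ^ 2
  | 0, 2, 2 => -(w' s * w' s + w s * w'' s)
  | _, _, _ => 0

theorem hasDerivAt_sq_inv {u : ℝ → ℝ} {u' t : ℝ} (h : HasDerivAt u u' t) (h0 : u t ≠ 0) :
    HasDerivAt (fun t => (u t ^ 2)⁻¹) (-(2 * u t * u') / (u t ^ 2) ^ 2) t := by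
  simpa using (h.fun_pow 2).fun_inv (pow_ne_zero 2 h0)

theorem hasDerivAt_lameFactor₃ {u u' u'' v v' v'' : ℝ → ℝ} {t : ℝ}
    (hu : HasDerivAt u (u' t) t) (hu' : HasDerivAt u' (u'' t) t) (hu0 : u t ≠ 0)
    (hv : HasDerivAt v (v' t) t) (hv' : HasDerivAt v' (v'' t) t) (hv0 : v t ≠ 0)
    (k i j : Fin 3) :
    HasDerivAt (lameFactor₃ u u' v v' k i j) (lameFactorDeriv₃ u u' u'' v v' v'' k i j t) t := by
  unfold lameFactor₃ lameFactorDeriv₃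
  fin_cases k <;> fin_cases i <;> fin_cases j <;>
    first
    | exact hasDerivAt_const t _
    | exact hu'.fun_div hu hu0
    | exact (hu.fun_mul hu').fun_neg
    | exact hv'.fun_div hv hv0
    | exact (hv.fun_mul hv').fun_neg
    | exact hasDerivAt_sq_inv hu hu0

theorem hasDerivAt_lameFactor₁ {w w' w'' : ℝ → ℝ} {s : ℝ}
    (hw : HasDerivAt w (w' s) s) (hw' : HasDerivAt w' (w'' s) s) (hw0 : w s ≠ 0)
    (k i j : Fin 3) :
    HasDerivAt (lameFactor₁ w w' k i j) (lameFactorDeriv₁ w w' w'' k i j s) s := by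
  unfold lameFactor₁ lameFactorDeriv₁
  fin_cases k <;> fin_cases i <;> fin_cases j <;>
    first
    | exact hasDerivAt_const s _
    | exact hw'.fun_div hw hw0
    | exact (hw.fun_mul hw').fun_neg
    | exact hasDerivAt_sq_inv hw hw0

/-- Closed forms of the Christoffel symbols hold only on the box; its openness allows them to be
differentiated. -/
theorem partialDeriv_congr_of_isOpen {n : ℕ} {U : Set (Fin n → ℝ)} (hU : IsOpen U)
    {f g : (Fin n → ℝ) → ℝ} (hfg : EqOn f g U) {x : Fin n → ℝ} (hx : x ∈ U) (i : Fin n) :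
    partialDeriv i f x = partialDeriv i g x := by
  unfold partialDeriv
  apply Filter.EventuallyEq.deriv_eq
  have hc : Continuous fun t => Function.update x i t := continuous_const.update i continuous_id
  have hm : (fun t => Function.update x i t) ⁻¹' U ∈ 𝓝 (x i) :=
    (hU.preimage hc).mem_nhds (by simpa using hx)
  filter_upwards [hm] with t ht using hfg ht

theorem isOpen_box {I₁ I₂ I₃ : Set ℝ} (h₁ : IsOpen I₁) (h₂ : IsOpen I₂) (h₃ : IsOpen I₃) :
    IsOpen (box I₁ I₂ I₃) :=
  (h₁.preimage (continuous_apply 0)).inter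
    ((h₂.preimage (continuous_apply 1)).inter (h₃.preimage (continuous_apply 2)))

theorem inv_lameMetric {u v w : ℝ → ℝ} {x : Fin 3 → ℝ} (hu : u (x 2) ≠ 0) (hv : v (x 2) ≠ 0)
    (hw : w (x 0) ≠ 0) :
    (lameMetric u v w x)⁻¹ =
      Matrix.diagonal ![(u (x 2) ^ 2)⁻¹, (v (x 2) ^ 2)⁻¹, (w (x 0) ^ 2)⁻¹] := by
  apply Matrix.inv_eq_right_inv
  rw [lameMetric, Matrix.diagonal_mul_diagonal, ← Matrix.diagonal_one]
  congr 1
  funext i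
  fin_cases i <;> simp [hu, hv, hw]

/-- Each metric coefficient depends on x³ alone or on x¹ alone, so every symbol splits as a product
and its partial derivatives become one-variable derivatives. -/
theorem christoffel_lameMetric {u u' v v' w w' : ℝ → ℝ} {x : Fin 3 → ℝ}
    (hu : HasDerivAt u (u' (x 2)) (x 2)) (hu0 : u (x 2) ≠ 0)
    (hv : HasDerivAt v (v' (x 2)) (x 2)) (hv0 : v (x 2) ≠ 0)
    (hw : HasDerivAt w (w' (x 0)) (x 0)) (hw0 : w (x 0) ≠ 0) (k i j : Fin 3) :
    christoffel (lameMetric u v w) k i j x =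
      lameFactor₃ u u' v v' k i j (x 2) * lameFactor₁ w w' k i j (x 0) := by
  have hu2 : deriv (fun t => u t ^ 2) (x 2) = 2 * u (x 2) * u' (x 2) := by
    simpa using (hu.fun_pow 2).deriv
  have hv2 : deriv (fun t => v t ^ 2) (x 2) = 2 * v (x 2) * v' (x 2) := by
    simpa using (hv.fun_pow 2).deriv
  have hw2 : deriv (fun t => w t ^ 2) (x 0) = 2 * w (x 0) * w' (x 0) := by
    simpa using (hw.fun_pow 2).deriv
  rw [christoffel, inv_lameMetric hu0 hv0 hw0, Fin.sum_univ_three]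
  fin_cases k <;> fin_cases i <;> fin_cases j <;>
    simp [lameMetric, partialDeriv, lameFactor₃, lameFactor₁,
      hu2, hv2, hw2] <;> field_simp

theorem partialDeriv_mul_factors {A B : ℝ → ℝ} {x : Fin 3 → ℝ} {A' B' : ℝ}
    (hA : HasDerivAt A A' (x 2)) (hB : HasDerivAt B B' (x 0)) (i : Fin 3) :
    partialDeriv i (fun y => A (y 2) * B (y 0)) x = ![A (x 2) * B', 0, A' * B (x 0)] i := by
  fin_cases i
  · simpa [partialDeriv, Function.update_apply] using (hB.const_mul (A (x 2))).deriv
  · simp [partialDeriv]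
  · simpa [partialDeriv, Function.update_apply] using (hA.mul_const (B (x 0))).deriv

theorem riemann_swap {n : ℕ} (G : (Fin n → ℝ) → Matrix (Fin n) (Fin n) ℝ) (l i j k : Fin n)
    (x : Fin n → ℝ) : riemann G l i j k x = -riemann G l j i k x := by
  simp only [riemann, Finset.sum_sub_distrib]
  ring

theorem riemann_self {n : ℕ} (G : (Fin n → ℝ) → Matrix (Fin n) (Fin n) ℝ) (l i k : Fin n)
    (x : Fin n → ℝ) : riemann G l i i k x = 0 := by
  simp [riemann]

theorem riemann_lameMetric {I₁ I₂ I₃ : Set ℝ} (h₁ : IsOpen I₁) (h₂ : IsOpen I₂) (h₃ : IsOpen I₃)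
    {u u' u'' v v' v'' w w' w'' : ℝ → ℝ}
    (hu : ∀ t ∈ I₃, HasDerivAt u (u' t) t) (hu' : ∀ t ∈ I₃, HasDerivAt u' (u'' t) t)
    (hu0 : ∀ t ∈ I₃, u t ≠ 0)
    (hv : ∀ t ∈ I₃, HasDerivAt v (v' t) t) (hv' : ∀ t ∈ I₃, HasDerivAt v' (v'' t) t)
    (hv0 : ∀ t ∈ I₃, v t ≠ 0)
    (hw : ∀ s ∈ I₁, HasDerivAt w (w' s) s) (hw' : ∀ s ∈ I₁, HasDerivAt w' (w'' s) s)
    (hw0 : ∀ s ∈ I₁, w s ≠ 0) {x : Fin 3 → ℝ} (hx : x ∈ box I₁ I₂ I₃) (l i j k : Fin 3) :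
    let A := fun l i j => lameFactor₃ u u' v v' l i j (x 2)
    let A' := fun l i j => lameFactorDeriv₃ u u' u'' v v' v'' l i j (x 2)
    let B := fun l i j => lameFactor₁ w w' l i j (x 0)
    let B' := fun l i j => lameFactorDeriv₁ w w' w'' l i j (x 0)
    riemann (lameMetric u v w) l i j k x =
      ![A l j k * B' l j k, 0, A' l j k * B l j k] i
        - ![A l i k * B' l i k, 0, A' l i k * B l i k] j
        + ∑ m, (A l i m * B l i m * (A m j k * B m j k)
          - A l j m * B l j m * (A m i k * B m i k)) := by
  intro A A' B B'
  have hΓ : ∀ k i j, EqOn (christoffel (lameMetric u v w) k i j)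
      (fun y => lameFactor₃ u u' v v' k i j (y 2) * lameFactor₁ w w' k i j (y 0))
      (box I₁ I₂ I₃) := fun k i j y hy =>
    christoffel_lameMetric (hu _ hy.2.2) (hu0 _ hy.2.2) (hv _ hy.2.2) (hv0 _ hy.2.2)
      (hw _ hy.1) (hw0 _ hy.1) k i j
  have hd : ∀ p k i j, partialDeriv p (christoffel (lameMetric u v w) k i j) x =
      ![A k i j * B' k i j, 0, A' k i j * B k i j] p := fun p k i j => by
    rw [partialDeriv_congr_of_isOpen (isOpen_box h₁ h₂ h₃) (hΓ k i j) hx]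
    exact partialDeriv_mul_factors
      (hasDerivAt_lameFactor₃ (hu _ hx.2.2) (hu' _ hx.2.2) (hu0 _ hx.2.2) (hv _ hx.2.2)
        (hv' _ hx.2.2) (hv0 _ hx.2.2) k i j)
      (hasDerivAt_lameFactor₁ (hw _ hx.1) (hw' _ hx.1) (hw0 _ hx.1) k i j) p
  simp only [riemann, hd, fun k i j => hΓ k i j hx, A, B]

set_option maxHeartbeats 1600000 in
/-- The metric `u(x³)² (dx¹)² + v(x³)² (dx²)² + w(x¹)² (dx³)²` is flat if and only if its
coefficients solve the Lamé equations. -/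
theorem isFlatOn_lameMetric_iff {I₁ I₂ I₃ : Set ℝ} (h₁ : IsOpen I₁) (h₂ : IsOpen I₂)
    (h₃ : IsOpen I₃) (hne : I₂.Nonempty) {u u' u'' v v' v'' w w' w'' : ℝ → ℝ}
    (hu : ∀ t ∈ I₃, HasDerivAt u (u' t) t) (hu' : ∀ t ∈ I₃, HasDerivAt u' (u'' t) t)
    (hu0 : ∀ t ∈ I₃, u t ≠ 0)
    (hv : ∀ t ∈ I₃, HasDerivAt v (v' t) t) (hv' : ∀ t ∈ I₃, HasDerivAt v' (v'' t) t)
    (hv0 : ∀ t ∈ I₃, v t ≠ 0)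
    (hw : ∀ s ∈ I₁, HasDerivAt w (w' s) s) (hw' : ∀ s ∈ I₁, HasDerivAt w' (w'' s) s)
    (hw0 : ∀ s ∈ I₁, w s ≠ 0) :
    IsFlatOn (lameMetric u v w) (box I₁ I₂ I₃) ↔
      ∀ s ∈ I₁, ∀ t ∈ I₃, v'' t = 0 ∧ u' t * v' t = 0 ∧ v' t * w' s = 0 ∧
        u t * u'' t + w s * w'' s = 0 := by
  constructor
  · intro h s hs t ht
    obtain ⟨y, hy⟩ := hne
    have hx : (![s, y, t] : Fin 3 → ℝ) ∈ box I₁ I₂ I₃ := ⟨hs, hy, ht⟩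
    have hR := fun l i j k =>
      (riemann_lameMetric h₁ h₂ h₃ hu hu' hu0 hv hv' hv0 hw hw' hw0 hx l i j k).symm.trans
        (h _ hx l i j k)
    have hut := hu0 t ht
    have hvt := hv0 t ht
    have hws := hw0 s hs
    -- Four curvature components, one for each equation, already suffice.
    refine ⟨?_, ?_, ?_, ?_⟩
    · have := hR 1 2 1 2
      simp [Fin.sum_univ_three, lameFactor₃, lameFactor₁, lameFactorDeriv₃, lameFactorDeriv₁]
        at this
      field_simp at this
      exact (mul_eq_zero.1 (by linarith : v'' t * v t = 0)).resolve_right hvt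
    · have := hR 1 0 1 0
      simp [Fin.sum_univ_three, lameFactor₃, lameFactor₁, lameFactorDeriv₃, lameFactorDeriv₁, hut,
        hvt, hws] at this
      simpa [or_comm] using this
    · have := hR 1 0 1 2
      simpa [Fin.sum_univ_three, lameFactor₃, lameFactor₁, lameFactorDeriv₃, lameFactorDeriv₁, hvt,
        hws] using this
    · have := hR 0 2 0 2
      simp [Fin.sum_univ_three, lameFactor₃, lameFactor₁, lameFactorDeriv₃, lameFactorDeriv₁]
        at this
      field_simp at this
      linarith
  · intro h x hx
    obtain ⟨e₁, e₂, e₃, e₄⟩ := h _ hx.1 _ hx.2.2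
    have hut := hu0 _ hx.2.2
    have hvt := hv0 _ hx.2.2
    have hws := hw0 _ hx.1
    have hR := riemann_lameMetric h₁ h₂ h₃ hu hu' hu0 hv hv' hv0 hw hw' hw0 hx
    generalize x 0 = s at *
    generalize x 2 = t at *
    -- By antisymmetry in i and j, only the pairs (0,1), (0,2), (1,2) have to be computed.
    have h01 : ∀ l k, riemann (lameMetric u v w) l 0 1 k x = 0 := fun l k => by
      rw [hR]
      fin_cases l <;> fin_cases k <;>
        simp [Fin.sum_univ_three, lameFactor₃, lameFactor₁, lameFactorDeriv₃, lameFactorDeriv₁] <;>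
        grind
    have h02 : ∀ l k, riemann (lameMetric u v w) l 0 2 k x = 0 := fun l k => by
      rw [hR]
      fin_cases l <;> fin_cases k <;>
        simp [Fin.sum_univ_three, lameFactor₃, lameFactor₁, lameFactorDeriv₃, lameFactorDeriv₁] <;>
        field_simp <;>
        first | ring1 | linear_combination e₄ | linear_combination -e₄
    have h12 : ∀ l k, riemann (lameMetric u v w) l 1 2 k x = 0 := fun l k => by
      rw [hR]
      fin_cases l <;> fin_cases k <;>
        simp [Fin.sum_univ_three, lameFactor₃, lameFactor₁, lameFactorDeriv₃, lameFactorDeriv₁] <;>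
        grind
    intro l i j k
    fin_cases i <;> fin_cases j
    · exact riemann_self _ _ _ _ _
    · exact h01 l k
    · exact h02 l k
    · simpa [h01] using riemann_swap (lameMetric u v w) l 1 0 k x
    · exact riemann_self _ _ _ _ _
    · exact h12 l k
    · simpa [h02] using riemann_swap (lameMetric u v w) l 2 0 k x
    · simpa [h12] using riemann_swap (lameMetric u v w) l 2 1 k x
    · exact riemann_self _ _ _ _ _

end Curvature

/-! ### The equation uu'' = -k and its solutions by quadrature. -/

section LogForm

/-- The set on which the function `z ↦ 1 / √(-2 k ln |z| + r)` is defined. -/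
def logDomain (k r : ℝ) : Set ℝ :=
  {z | z ≠ 0 ∧ 0 < -2 * k * Real.log |z| + r}

theorem hasDerivAt_logExpr (k r : ℝ) {z : ℝ} (hz : z ≠ 0) :
    HasDerivAt (fun z => -2 * k * Real.log |z| + r) (-2 * k * z⁻¹) z := by
  simpa using ((Real.hasDerivAt_log hz).const_mul (-2 * k)).add_const r

theorem continuousOn_logExpr (k r : ℝ) :
    ContinuousOn (fun z => -2 * k * Real.log |z| + r) {z | z ≠ 0} := fun _ hz =>
  (hasDerivAt_logExpr k r hz).continuousAt.continuousWithinAt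

theorem isOpen_logDomain (k r : ℝ) : IsOpen (logDomain k r) :=
  (continuousOn_logExpr k r).isOpen_inter_preimage isOpen_ne isOpen_Ioi

/-- A maximal connected subset is a connected component, and components of open subsets of ℝ are
open. -/
theorem isOpen_of_isMaximalDomain {k r : ℝ} {D : Set ℝ} (h : IsMaximalDomain k r D) :
    IsOpen D := by
  obtain ⟨z, hz⟩ := h.prop.1.nonempty
  have hzS : z ∈ logDomain k r := h.prop.2 hz
  have hD : D = connectedComponentIn (logDomain k r) z :=
    h.eq_of_subset ⟨isConnected_connectedComponentIn_iff.2 hzS, connectedComponentIn_subset _ _⟩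
      (h.prop.1.isPreconnected.subset_connectedComponentIn hz h.prop.2)
  rw [hD]
  exact (isOpen_logDomain k r).connectedComponentIn

theorem exists_isMaximalDomain {k r : ℝ} {S : Set ℝ} (hS : IsConnected S)
    (hsub : S ⊆ logDomain k r) : ∃ D, IsMaximalDomain k r D ∧ S ⊆ D := by
  obtain ⟨z, hz⟩ := hS.nonempty
  refine ⟨connectedComponentIn (logDomain k r) z,
    ⟨⟨isConnected_connectedComponentIn_iff.2 (hsub hz), connectedComponentIn_subset _ _⟩, ?_⟩,
    hS.isPreconnected.subset_connectedComponentIn hz hsub⟩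
  intro T hT hle
  exact hT.1.isPreconnected.subset_connectedComponentIn
    (hle (mem_connectedComponentIn (hsub hz))) hT.2

theorem exists_isLogAntideriv {k r : ℝ} {D : Set ℝ} (hD : IsMaximalDomain k r D) :
    ∃ F, IsLogAntideriv k r D F := by
  obtain ⟨a, ha⟩ := hD.prop.1.nonempty
  have hopen := isOpen_of_isMaximalDomain hD
  have hord : D.OrdConnected := hD.prop.1.isPreconnected.ordConnected
  have hc : ContinuousOn (fun z => 1 / √(-2 * k * Real.log |z| + r)) D :=
    continuousOn_const.div
      (((continuousOn_logExpr k r).mono fun z hz => (hD.prop.2 hz).1).sqrt)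
      fun z hz => (Real.sqrt_pos.2 (hD.prop.2 hz).2).ne'
  refine ⟨fun z => ∫ y in a..z, 1 / √(-2 * k * Real.log |y| + r), fun z hz => ?_⟩
  exact intervalIntegral.integral_hasDerivAt_right
    (hc.mono (hord.uIcc_subset ha hz)).intervalIntegrable
    (hc.stronglyMeasurableAtFilter hopen z hz) (hc.continuousAt (hopen.mem_nhds hz))

/-- The derivative of F is positive on the interval D. Injectivity makes `Function.invFunOn F D` a
left inverse of F on D. -/
theorem injOn_of_isLogAntideriv {k r : ℝ} {D : Set ℝ} {F : ℝ → ℝ} (hD : IsMaximalDomain k r D)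
    (hF : IsLogAntideriv k r D F) : InjOn F D := by
  have hconv : Convex ℝ D := hD.prop.1.isPreconnected.convex
  refine (strictMonoOn_of_deriv_pos hconv
    (fun z hz => (hF z hz).continuousAt.continuousWithinAt) fun z hz => ?_).injOn
  have hz' := interior_subset hz
  rw [(hF z hz').deriv]
  exact one_div_pos.2 (Real.sqrt_pos.2 (hD.prop.2 hz').2)

theorem exists_eq_affine_of_hasDerivAt {I : Set ℝ} (hI : IsOpen I) (hc : IsPreconnected I)
    {g : ℝ → ℝ} {a : ℝ} (h : ∀ x ∈ I, HasDerivAt g a x) : ∃ c, ∀ x ∈ I, g x = a * x + c := by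
  have hd : ∀ x ∈ I, HasDerivAt (fun x => g x - a * x) 0 x := fun x hx => by
    simpa using (h x hx).fun_sub ((hasDerivAt_id x).const_mul a)
  obtain ⟨c, hc⟩ := hI.exists_is_const_of_deriv_eq_zero hc
    (fun x hx => (hd x hx).differentiableAt.differentiableWithinAt) fun x hx => (hd x hx).deriv
  exact ⟨c, fun x hx => by linarith [hc x hx]⟩

theorem sign_sq_of_ne_zero {x : ℝ} (hx : x ≠ 0) : Real.sign x ^ 2 = 1 := by
  rcases Real.sign_apply_eq_of_ne_zero x hx with h | h <;> simp [h]

/-- Differentiating F(u) = ηx + d gives u' = η√(-2k ln|u| + r); differentiating once more gives u''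
= -kη²/u. -/
theorem mul_deriv_deriv_eq_of_antideriv_comp_eq {k r η d : ℝ} {D J : Set ℝ} {F u u' u'' : ℝ → ℝ}
    (hDS : D ⊆ logDomain k r) (hF : IsLogAntideriv k r D F) (hJ : IsOpen J) (hη : η ^ 2 = 1)
    (hu : ∀ x ∈ J, HasDerivAt u (u' x) x) (hu' : ∀ x ∈ J, HasDerivAt u' (u'' x) x)
    (hD : ∀ x ∈ J, u x ∈ D) (hFu : ∀ x ∈ J, F (u x) = η * x + d) {x : ℝ} (hx : x ∈ J) :
    u x * u'' x = -k := by
  have hE : ∀ y ∈ J, u' y = η * √(-2 * k * Real.log |u y| + r) := fun y hy => by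
    have h₁ := (hF _ (hD y hy)).comp y (hu y hy)
    have h₂ : HasDerivAt (F ∘ u) η y := by
      have : HasDerivAt (fun x => η * x + d) η y := by
        simpa using ((hasDerivAt_id y).const_mul η).add_const d
      exact this.congr_of_eventuallyEq
        (Filter.mem_of_superset (hJ.mem_nhds hy) fun z hz => hFu z hz)
    have h := h₁.unique h₂
    have hpos := Real.sqrt_pos.2 (hDS (hD y hy)).2
    generalize √(-2 * k * Real.log |u y| + r) = q at h hpos ⊢
    field_simp at h
    linarith
  obtain ⟨hne, hpos⟩ := hDS (hD x hx)
  have h₁ := ((((hasDerivAt_logExpr k r hne).comp x (hu x hx)).sqrt hpos.ne').const_mul η)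
  have h₂ := h₁.congr_of_eventuallyEq
    (Filter.mem_of_superset (hJ.mem_nhds hx) fun z hz => hE z hz)
  rw [(hu' x hx).unique h₂, hE x hx]
  have hs := (Real.sqrt_pos.2 hpos).ne'
  simp only [Function.comp_apply]
  generalize √(-2 * k * Real.log |u x| + r) = q at hs ⊢
  field_simp
  linear_combination (-k) * hη

theorem mul_deriv_deriv_eq_of_isLogForm {k : ℝ} (hk : k ≠ 0) {I : Set ℝ} {f u' u'' : ℝ → ℝ}
    (hI : IsOpen I)
    (hu : ∀ x ∈ I, HasDerivAt (fun x => (f x)⁻¹) (u' x) x)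
    (hu' : ∀ x ∈ I, HasDerivAt u' (u'' x) x) (hu'' : ContinuousOn u'' I)
    (h : IsLogForm k I f) : ∀ x ∈ I, (f x)⁻¹ * u'' x = -k := by
  obtain ⟨r, D, F, hD, hF, ⟨η, d, hη, hm⟩ | hg⟩ := h
  · intro x hx
    refine mul_deriv_deriv_eq_of_antideriv_comp_eq hD.prop.2 hF hI (η := η) (d := d)
      (by rcases hη with rfl | rfl <;> norm_num) hu hu' (fun y hy => ?_) (fun y hy => ?_) hx
    · rw [(hm y hy).2, one_div, inv_inv]
      exact Function.invFunOn_mem (hm y hy).1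
    · rw [(hm y hy).2, one_div, inv_inv]
      exact Function.invFunOn_eq (hm y hy).1
  · obtain ⟨z₀, hz₀, x₀, hx₀, ε, c, L, ℓ, hε, -, -, -, hl, -, hr⟩ := hg
    have hε2 : ε ^ 2 = 1 := hε ▸ sign_sq_of_ne_zero (mul_ne_zero (neg_ne_zero.2 hk) hz₀.2)
    have hne : ∀ x ∈ I, x ≠ x₀ → (f x)⁻¹ * u'' x = -k := by
      intro x hx hxx
      rcases hxx.lt_or_gt with hlt | hlt
      · refine mul_deriv_deriv_eq_of_antideriv_comp_eq hD.prop.2 hF (hI.inter isOpen_Iio)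
          (η := -ε) (d := 2 * ε * x₀ + c) (J := I ∩ Iio x₀) (by simpa using hε2)
          (fun y hy => hu y hy.1) (fun y hy => hu' y hy.1) (fun y hy => ?_) (fun y hy => ?_)
          ⟨hx, hlt⟩
        · rw [(hl y hy.1 hy.2).2, one_div, inv_inv]
          exact Function.invFunOn_mem (hl y hy.1 hy.2).1
        · rw [(hl y hy.1 hy.2).2, one_div, inv_inv, ← add_assoc]
          exact Function.invFunOn_eq (hl y hy.1 hy.2).1
      · refine mul_deriv_deriv_eq_of_antideriv_comp_eq hD.prop.2 hF (hI.inter isOpen_Ioi)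
          (η := ε) (d := c) (J := I ∩ Ioi x₀) hε2
          (fun y hy => hu y hy.1) (fun y hy => hu' y hy.1) (fun y hy => ?_) (fun y hy => ?_)
          ⟨hx, hlt⟩
        · rw [(hr y hy.1 hy.2).2, one_div, inv_inv]
          exact Function.invFunOn_mem (hr y hy.1 hy.2).1
        · rw [(hr y hy.1 hy.2).2, one_div, inv_inv]
          exact Function.invFunOn_eq (hr y hy.1 hy.2).1
    intro x hx
    by_cases hxx : x = x₀
    · subst hxx
      -- At the gluing point the equation follows by continuity from the punctured neighbourhood.
      have hcont : ContinuousAt (fun y => (f y)⁻¹ * u'' y) x :=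
        (hu x hx).continuousAt.mul (hu''.continuousAt (hI.mem_nhds hx))
      have hev : ∀ᶠ y in 𝓝[≠] x, (f y)⁻¹ * u'' y = -k := by
        filter_upwards [mem_nhdsWithin_of_mem_nhds (hI.mem_nhds hx), self_mem_nhdsWithin]
          with y hy hyx using hne y hy hyx
      exact tendsto_nhds_unique_of_eventuallyEq
        (hcont.tendsto.mono_left nhdsWithin_le_nhds) tendsto_const_nhds hev
    · exact hne x hx hxx

theorem forall_pos_or_forall_neg {I : Set ℝ} (hI : IsPreconnected I) {g : ℝ → ℝ}
    (hg : ContinuousOn g I) (h0 : ∀ x ∈ I, g x ≠ 0) :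
    (∀ x ∈ I, 0 < g x) ∨ ∀ x ∈ I, g x < 0 := by
  by_contra! h
  obtain ⟨⟨a, ha, hga⟩, b, hb, hgb⟩ := h
  obtain ⟨c, hc, hgc⟩ := hI.intermediate_value ha hb hg ⟨hga, hgb⟩
  exact h0 c hc hgc

/-- Conservation of energy: u'² + 2k ln|u| has derivative 2u'(u'' + k/u) = 0. -/
theorem exists_sq_deriv_eq {k : ℝ} {I : Set ℝ} {u u' u'' : ℝ → ℝ} (hI : IsOpen I)
    (hIc : IsPreconnected I) (hu : ∀ x ∈ I, HasDerivAt u (u' x) x)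
    (hu' : ∀ x ∈ I, HasDerivAt u' (u'' x) x) (hu0 : ∀ x ∈ I, u x ≠ 0)
    (hode : ∀ x ∈ I, u x * u'' x = -k) :
    ∃ r, ∀ x ∈ I, -2 * k * Real.log |u x| + r = u' x ^ 2 := by
  obtain ⟨r, hr⟩ := exists_eq_affine_of_hasDerivAt hI hIc
    (g := fun x => u' x ^ 2 + 2 * k * Real.log (u x)) (a := 0) fun x hx => by
      refine (((hu' x hx).fun_pow 2).add (((hu x hx).log (hu0 x hx)).const_mul (2 * k))).congr_deriv
        ?_
      have := hu0 x hx
      field_simp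
      linear_combination 2 * u' x * hode x hx
  exact ⟨r, fun x hx => by rw [Real.log_abs]; linarith [hr x hx]⟩

/-- By the first integral the square root is |u'|, so F ∘ u has derivative u'/|u'| = σ. -/
theorem hasDerivAt_antideriv_comp {k r : ℝ} {D : Set ℝ} {F u u' : ℝ → ℝ}
    (hF : IsLogAntideriv k r D F) {x : ℝ} (hu : HasDerivAt u (u' x) x) (hx : u x ∈ D)
    (hE : -2 * k * Real.log |u x| + r = u' x ^ 2) {σ : ℝ} (hσ : σ = 1 ∨ σ = -1)
    (hpos : 0 < σ * u' x) : HasDerivAt (fun x => F (u x)) σ x := by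
  refine ((hF _ hx).comp x hu).congr_deriv ?_
  rw [hE, Real.sqrt_sq_eq_abs]
  rcases hσ with rfl | rfl
  · have : 0 < u' x := by linarith
    rw [abs_of_pos this]
    field_simp
  · have : u' x < 0 := by linarith
    rw [abs_of_neg this, one_div_mul_eq_div, div_neg, div_self this.ne]

theorem isLogForm_of_deriv_ne_zero {k r : ℝ} {I : Set ℝ} {f u' : ℝ → ℝ} (hI : IsOpen I)
    (hIc : IsConnected I) (hu : ∀ x ∈ I, HasDerivAt (fun x => (f x)⁻¹) (u' x) x)
    (hc : ContinuousOn u' I) (hf0 : ∀ x ∈ I, f x ≠ 0)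
    (hE : ∀ x ∈ I, -2 * k * Real.log |(f x)⁻¹| + r = u' x ^ 2) (hne : ∀ x ∈ I, u' x ≠ 0) :
    IsLogForm k I f := by
  have hS : (fun x => (f x)⁻¹) '' I ⊆ logDomain k r := by
    rintro _ ⟨x, hx, rfl⟩
    exact ⟨inv_ne_zero (hf0 x hx), by rw [hE x hx]; exact sq_pos_of_ne_zero (hne x hx)⟩
  obtain ⟨D, hD, hsub⟩ := exists_isMaximalDomain
    (hIc.image _ fun x hx => (hu x hx).continuousAt.continuousWithinAt) hS
  obtain ⟨F, hF⟩ := exists_isLogAntideriv hD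
  obtain ⟨σ, hσ, hpos⟩ : ∃ σ : ℝ, (σ = 1 ∨ σ = -1) ∧ ∀ x ∈ I, 0 < σ * u' x := by
    rcases forall_pos_or_forall_neg hIc.isPreconnected hc hne with h | h
    · exact ⟨1, Or.inl rfl, fun x hx => by simpa using h x hx⟩
    · exact ⟨-1, Or.inr rfl, fun x hx => by simpa using h x hx⟩
  obtain ⟨d, hd⟩ := exists_eq_affine_of_hasDerivAt hI hIc.isPreconnected fun x hx =>
    hasDerivAt_antideriv_comp hF (hu x hx) (hsub (mem_image_of_mem _ hx)) (hE x hx) hσ (hpos x hx)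
  refine ⟨r, D, F, hD, hF, Or.inl ⟨σ, d, hσ, fun x hx => ?_⟩⟩
  have hxD := hsub (mem_image_of_mem _ hx)
  rw [← hd x hx]
  refine ⟨mem_image_of_mem F hxD, ?_⟩
  rw [(injOn_of_isLogAntideriv hD hF).leftInvOn_invFunOn hxD, one_div, inv_inv]

theorem sign_mul_pos_iff {a b : ℝ} (ha : a ≠ 0) : 0 < Real.sign a * b ↔ 0 < a * b := by
  rcases ha.lt_or_gt with ha | ha
  · rw [Real.sign_of_neg ha, mul_pos_iff, mul_pos_iff]
    simp [ha, ha.not_gt]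
  · rw [Real.sign_of_pos ha, one_mul, mul_pos_iff_of_pos_left ha]

/-- For `z` and `z₀` of the same sign, `-k (ln |z| - ln |z₀|)` is positive if and only if
`-k z₀ (z - z₀)` is. -/
theorem logExpr_pos_iff {k z z₀ : ℝ} (hk : k ≠ 0) (hz : 0 < z * z₀) :
    0 < -2 * k * Real.log |z| + 2 * k * Real.log |z₀| ↔
      0 < Real.sign (-k * z₀) * (z - z₀) := by
  have key : ∀ {a b : ℝ}, 0 < a → 0 < b → (0 < -2 * k * Real.log a + 2 * k * Real.log b ↔
      0 < -k * (a - b)) := fun {a b} ha hb => by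
    have h : -2 * k * Real.log a + 2 * k * Real.log b = 2 * (-k * (Real.log a - Real.log b)) := by
      ring
    rw [h, mul_pos_iff_of_pos_left two_pos, mul_pos_iff, mul_pos_iff, sub_pos, sub_pos, sub_neg,
      sub_neg, Real.log_lt_log_iff ha hb, Real.log_lt_log_iff hb ha]
  rcases mul_pos_iff.1 hz with ⟨h₁, h₂⟩ | ⟨h₁, h₂⟩
  · rw [abs_of_pos h₁, abs_of_pos h₂, key h₁ h₂,
      sign_mul_pos_iff (mul_ne_zero (neg_ne_zero.2 hk) h₂.ne'),
      mul_right_comm, mul_pos_iff_of_pos_right h₂]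
  · rw [abs_of_neg h₁, abs_of_neg h₂, key (neg_pos.2 h₁) (neg_pos.2 h₂),
      sign_mul_pos_iff (mul_ne_zero (neg_ne_zero.2 hk) h₂.ne),
      show -k * z₀ * (z - z₀) = (-k * (-z - -z₀)) * -z₀ by ring,
      mul_pos_iff_of_pos_right (neg_pos.2 h₂)]

/-- With r = 2k ln|z₀| the radicand vanishes at z₀. The points of the sign of z₀ with positive
radicand form an interval on one side of z₀, and a connected set avoiding 0 cannot reach the other
sign. -/
theorem isMaximalDomain_halfLine {k z₀ : ℝ} (hk : k ≠ 0) {D : Set ℝ}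
    (hD : D = {z | 0 < z * z₀ ∧ 0 < Real.sign (-k * z₀) * (z - z₀)}) (hne : D.Nonempty) :
    IsMaximalDomain k (2 * k * Real.log |z₀|) D := by
  have hconv : Convex ℝ D := by
    rw [hD]
    have h₁ : Convex ℝ {z : ℝ | 0 < z * z₀} :=
      (convex_Ioi (0 : ℝ)).is_linear_preimage 
        ⟨fun a b => add_mul a b z₀, fun a b => mul_assoc a b z₀⟩
    have h₂ : Convex ℝ {z : ℝ | 0 < Real.sign (-k * z₀) * (z - z₀)} := by
      have h : {z : ℝ | 0 < Real.sign (-k * z₀) * (z - z₀)} =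
          (fun z => Real.sign (-k * z₀) * z) ⁻¹' Ioi (Real.sign (-k * z₀) * z₀) :=
        Set.ext fun z => by simp only [mem_ofPred_eq, mem_preimage, mem_Ioi, mul_sub, sub_pos]
      rw [h]
      exact (convex_Ioi _).is_linear_preimage ⟨mul_add _, fun a b => mul_left_comm _ a b⟩
    exact h₁.inter h₂
  refine ⟨⟨⟨hne, hconv.isPreconnected⟩, fun z hz => ?_⟩, fun T hT hle z hz => ?_⟩
  · rw [hD] at hz
    exact ⟨left_ne_zero_of_mul hz.1.ne', (logExpr_pos_iff hk hz.1).2 hz.2⟩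
  · obtain ⟨y, hy⟩ := hne
    have hyT := hle hy
    rw [hD] at hy ⊢
    have hzz : 0 < z * z₀ := by
      rcases forall_pos_or_forall_neg hT.1.isPreconnected (g := fun z => z * z₀)
        (by fun_prop) (fun x hx => mul_ne_zero (hT.2 hx).1 (right_ne_zero_of_mul hy.1.ne')) with h | h
      · exact h z hz
      · exact absurd hy.1 (h y hyT).not_gt
    exact ⟨hzz, (logExpr_pos_iff hk hzz).1 (hT.2 hz).2⟩

/-- By the intermediate value theorem, every z in D close to u(x₀) equals u(x) for some x slightly
to the right of x₀, where F(z) = εx + c. -/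
theorem tendsto_of_comp_eq_affine {D : Set ℝ} {F u : ℝ → ℝ} {ε c x₀ b : ℝ} (hb : x₀ < b)
    (hε : ε = 1 ∨ ε = -1) (hcont : ContinuousOn u (Ico x₀ b))
    (hD : ∀ z ∈ D, 0 < ε * (z - u x₀)) (huD : ∀ x ∈ Ioo x₀ b, u x ∈ D)
    (hFu : ∀ x ∈ Ioo x₀ b, F (u x) = ε * x + c) :
    Tendsto F (𝓝[D] (u x₀)) (𝓝 (ε * x₀ + c)) := by
  have hε0 : ε ≠ 0 := by rcases hε with rfl | rfl <;> norm_num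
  have hεa : |ε| = 1 := by rcases hε with rfl | rfl <;> norm_num
  rw [Metric.tendsto_nhds]
  intro e he
  obtain ⟨x₁, h₁, h₂⟩ := exists_between (lt_min hb (by linarith : x₀ < x₀ + e))
  rw [lt_min_iff] at h₂
  have hx₁ := hD _ (huD x₁ ⟨h₁, h₂.1⟩)
  have hnhds : {z | ε * z < ε * u x₁} ∈ 𝓝 (u x₀) :=
    (isOpen_lt (by fun_prop) continuous_const).mem_nhds (by
      simp only [mem_ofPred_eq]
      linarith)
  filter_upwards [mem_nhdsWithin_of_mem_nhds hnhds, self_mem_nhdsWithin] with z hz hzD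
  have hcont' : ContinuousOn (fun x => ε * u x) (Icc x₀ x₁) :=
    continuousOn_const.mul (hcont.mono fun x hx => ⟨hx.1, hx.2.trans_lt h₂.1⟩)
  obtain ⟨x, hx, hxz⟩ := intermediate_value_Ioo h₁.le hcont'
    (⟨by linarith [hD z hzD], hz⟩ : ε * z ∈ Ioo (ε * u x₀) (ε * u x₁))
  rw [← mul_left_cancel₀ hε0 hxz, hFu x ⟨hx.1, hx.2.trans h₂.1⟩, Real.dist_eq,
    show ε * x + c - (ε * x₀ + c) = ε * (x - x₀) by ring, abs_mul, hεa, one_mul,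
    abs_of_pos (sub_pos.2 hx.1)]
  linarith [hx.2]

/-- Since εu'' > 0, x₀ is the only critical point of u, and u leaves z₀ = u(x₀) into the same
interval D on both sides. -/
theorem isLogForm_of_deriv_eq_zero {k : ℝ} (hk : k ≠ 0) {I : Set ℝ} {f u' u'' : ℝ → ℝ}
    (hI : IsOpen I) (hIc : IsConnected I)
    (hu : ∀ x ∈ I, HasDerivAt (fun x => (f x)⁻¹) (u' x) x)
    (hu' : ∀ x ∈ I, HasDerivAt u' (u'' x) x) (hf0 : ∀ x ∈ I, f x ≠ 0)
    (hode : ∀ x ∈ I, (f x)⁻¹ * u'' x = -k) {r : ℝ}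
    (hE : ∀ x ∈ I, -2 * k * Real.log |(f x)⁻¹| + r = u' x ^ 2)
    {x₀ : ℝ} (hx₀ : x₀ ∈ I) (hx₀' : u' x₀ = 0) :
    IsLogForm k I f := by
  set u : ℝ → ℝ := fun x => (f x)⁻¹ with hudef
  have hu0 : ∀ x ∈ I, u x ≠ 0 := fun x hx => inv_ne_zero (hf0 x hx)
  have hcu : ContinuousOn u I := fun x hx => (hu x hx).continuousAt.continuousWithinAt
  have hfu : ∀ x, f x = 1 / u x := fun x => by simp [hudef]
  set z₀ : ℝ := u x₀ with hz₀
  have hz₀0 : z₀ ≠ 0 := hu0 x₀ hx₀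
  have hkz : -k * z₀ ≠ 0 := mul_ne_zero (neg_ne_zero.2 hk) hz₀0
  -- The first integral at the critical point x₀ determines r.
  obtain rfl : r = 2 * k * Real.log |z₀| := by
    have := hE x₀ hx₀
    rw [hx₀'] at this
    linarith
  set ε : ℝ := Real.sign (-k * z₀) with hεdef
  have hε : ε = 1 ∨ ε = -1 := (Real.sign_apply_eq_of_ne_zero _ hkz).symm
  have hsame : ∀ x ∈ I, 0 < u x * z₀ := by
    rcases forall_pos_or_forall_neg hIc.isPreconnected (hcu.mul_const z₀)
      (fun x hx => mul_ne_zero (hu0 x hx) hz₀0) with h | h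
    · exact h
    · exact absurd (mul_self_pos.2 hz₀0) (h x₀ hx₀).not_gt
  have hmono : StrictMonoOn (fun x => ε * u' x) I := by
    have hd : ∀ x ∈ I, HasDerivAt (fun x => ε * u' x) (ε * u'' x) x := fun x hx =>
      (hu' x hx).const_mul ε
    refine strictMonoOn_of_deriv_pos hIc.isPreconnected.convex
      (fun x hx => (hd x hx).continuousAt.continuousWithinAt) fun x hx => ?_
    have hxI := interior_subset hx
    rw [(hd x hxI).deriv, sign_mul_pos_iff hkz, ← hode x hxI]
    have h0 : u'' x ≠ 0 := fun h => by
      have := hode x hxI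
      rw [h, mul_zero] at this
      exact hk (neg_eq_zero.1 this.symm)
    have := mul_pos (hsame x hxI) (mul_self_pos.2 h0)
    calc 0 < u x * z₀ * (u'' x * u'' x) := this
      _ = u x * u'' x * z₀ * u'' x := by ring
  have hright : ∀ x ∈ I, x₀ < x → 0 < ε * u' x := fun x hx h => by
    simpa [hx₀'] using hmono hx₀ hx h
  have hleft : ∀ x ∈ I, x < x₀ → 0 < -ε * u' x := fun x hx h => by
    simpa [hx₀'] using hmono hx hx₀ h
  have hne : ∀ x ∈ I, x ≠ x₀ → u' x ≠ 0 := fun x hx hxx => by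
    rcases hxx.lt_or_gt with h | h
    · exact right_ne_zero_of_mul (hleft x hx h).ne'
    · exact right_ne_zero_of_mul (hright x hx h).ne'
  set D : Set ℝ := {z | 0 < z * z₀ ∧ 0 < ε * (z - z₀)} with hDdef
  have huD : ∀ x ∈ I, x ≠ x₀ → u x ∈ D := fun x hx hxx =>
    ⟨hsame x hx, (logExpr_pos_iff hk (hsame x hx)).1 (by
      rw [hE x hx]
      exact sq_pos_of_ne_zero (hne x hx hxx))⟩
  obtain ⟨b, hb, hbI⟩ := exists_Ico_subset_of_mem_nhds (hI.mem_nhds hx₀) (exists_gt x₀)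
  have hDne : D.Nonempty := by
    obtain ⟨x, h₁, h₂⟩ := exists_between hb
    exact ⟨u x, huD x (hbI ⟨h₁.le, h₂⟩) h₁.ne'⟩
  have hD : IsMaximalDomain k (2 * k * Real.log |z₀|) D := isMaximalDomain_halfLine hk rfl hDne
  obtain ⟨F, hF⟩ := exists_isLogAntideriv hD
  have hinv : ∀ x ∈ I, x ≠ x₀ → Function.invFunOn F D (F (u x)) = u x := fun x hx hxx =>
    (injOn_of_isLogAntideriv hD hF).leftInvOn_invFunOn (huD x hx hxx)
  have hord : I.OrdConnected := hIc.isPreconnected.ordConnected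
  obtain ⟨c, hc⟩ := exists_eq_affine_of_hasDerivAt (hI.inter isOpen_Ioi)
    (hord.inter ordConnected_Ioi).isPreconnected fun x (hx : x ∈ I ∩ Ioi x₀) =>
      hasDerivAt_antideriv_comp hF (hu x hx.1) (huD x hx.1 hx.2.ne') (hE x hx.1) hε
        (hright x hx.1 hx.2)
  obtain ⟨c', hc'⟩ := exists_eq_affine_of_hasDerivAt (hI.inter isOpen_Iio)
    (hord.inter ordConnected_Iio).isPreconnected fun x (hx : x ∈ I ∩ Iio x₀) =>
      hasDerivAt_antideriv_comp hF (hu x hx.1) (huD x hx.1 hx.2.ne) (hE x hx.1)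
        (σ := -ε) (by rcases hε with h | h <;> simp [h]) (hleft x hx.1 hx.2)
  have hL : Tendsto F (𝓝[D] z₀) (𝓝 (ε * x₀ + c)) :=
    tendsto_of_comp_eq_affine hb hε (hcu.mono hbI) (fun z hz => hz.2)
      (fun x hx => huD x (hbI ⟨hx.1.le, hx.2⟩) hx.1.ne')
      (fun x hx => hc x ⟨hbI ⟨hx.1.le, hx.2⟩, hx.1⟩)
  have hut : Tendsto u (𝓝 x₀) (𝓝 z₀) := (hu x₀ hx₀).continuousAt
  have hut' : Tendsto u (𝓝[≠] x₀) (𝓝[D] z₀) := by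
    refine tendsto_nhdsWithin_iff.2 ⟨hut.mono_left nhdsWithin_le_nhds, ?_⟩
    filter_upwards [mem_nhdsWithin_of_mem_nhds (hI.mem_nhds hx₀), self_mem_nhdsWithin]
      with x hx hxx using huD x hx hxx
  -- Both branches of F ∘ u have the limit of F at z₀ as their limit at x₀, which ties the left
  -- constant to the right one.
  have hcc : c' = 2 * ε * x₀ + c := by
    have h₁ : Tendsto (fun x => F (u x)) (𝓝[<] x₀) (𝓝 (ε * x₀ + c)) :=
      (hL.comp hut').mono_left (nhdsWithin_mono _ fun x (hx : x < x₀) => hx.ne)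
    have h₂ : Tendsto (fun x => -ε * x + c') (𝓝[<] x₀) (𝓝 (-ε * x₀ + c')) :=
      (Continuous.tendsto (by fun_prop) x₀).mono_left nhdsWithin_le_nhds
    have h₃ := tendsto_nhds_unique_of_eventuallyEq h₁ h₂ (by
      filter_upwards [mem_nhdsWithin_of_mem_nhds (hI.mem_nhds hx₀), self_mem_nhdsWithin]
        with x hx hxx using hc' x ⟨hx, hxx⟩)
    linarith
  subst hcc
  refine ⟨_, D, F, hD, hF, Or.inr ⟨z₀, ⟨?_, hz₀0⟩, x₀, hx₀, ε, c, ε * x₀ + c, z₀, rfl, hL,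
    by ring, ?_, fun x hx hxx => ?_, hfu x₀, fun x hx hxx => ?_⟩⟩
  · rw [(isOpen_of_isMaximalDomain hD).frontier_eq]
    refine ⟨mem_closure_of_tendsto (hut.mono_left nhdsWithin_le_nhds)
      (tendsto_nhdsWithin_iff.1 hut').2, fun h => ?_⟩
    simpa using h.2
  · refine (hut.mono_left nhdsWithin_le_nhds).congr' ?_
    filter_upwards [mem_nhdsWithin_of_mem_nhds (hI.mem_nhds hx₀), self_mem_nhdsWithin]
      with x hx hxx
    rw [← hc x ⟨hx, hxx⟩, hinv x hx (ne_of_gt hxx)]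
  · rw [show -ε * x + 2 * ε * x₀ + c = -ε * x + (2 * ε * x₀ + c) by ring, ← hc' x ⟨hx, hxx⟩]
    exact ⟨mem_image_of_mem F (huD x hx hxx.ne), by rw [hinv x hx hxx.ne, hfu]⟩
  · rw [← hc x ⟨hx, hxx⟩]
    exact ⟨mem_image_of_mem F (huD x hx hxx.ne'), by rw [hinv x hx hxx.ne', hfu]⟩

theorem isLogForm_of_mul_deriv_deriv_eq {k : ℝ} (hk : k ≠ 0) {I : Set ℝ} {f u' u'' : ℝ → ℝ}
    (hI : IsOpen I) (hIc : IsConnected I)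
    (hu : ∀ x ∈ I, HasDerivAt (fun x => (f x)⁻¹) (u' x) x)
    (hu' : ∀ x ∈ I, HasDerivAt u' (u'' x) x) (hf0 : ∀ x ∈ I, f x ≠ 0)
    (hode : ∀ x ∈ I, (f x)⁻¹ * u'' x = -k) : IsLogForm k I f := by
  obtain ⟨r, hr⟩ := exists_sq_deriv_eq hI hIc.isPreconnected hu hu'
    (fun x hx => inv_ne_zero (hf0 x hx)) hode
  by_cases h : ∃ x₀ ∈ I, u' x₀ = 0
  · obtain ⟨x₀, hx₀, h0⟩ := h
    exact isLogForm_of_deriv_eq_zero hk hI hIc hu hu' hf0 hode hr hx₀ h0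
  · push Not at h
    exact isLogForm_of_deriv_ne_zero hI hIc hu
      (fun x hx => (hu' x hx).continuousAt.continuousWithinAt) hf0 hr h

end LogForm

/-! ### Constant and reciprocal coefficients as affine solutions. -/

section Classification

theorem exists_hasDerivAt_inv {f : ℝ → ℝ} {I : Set ℝ} (hI : IsOpen I) (hf : ContDiffOn ℝ ∞ f I)
    (hf0 : ∀ t ∈ I, f t ≠ 0) :
    ∃ u' u'' : ℝ → ℝ, (∀ t ∈ I, HasDerivAt (fun t => (f t)⁻¹) (u' t) t) ∧
      (∀ t ∈ I, HasDerivAt u' (u'' t) t) ∧ ContinuousOn u'' I := by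
  have hu : ContDiffOn ℝ ∞ (fun t => (f t)⁻¹) I := hf.inv hf0
  have hu' := hu.deriv_of_isOpen (m := ∞) hI le_rfl
  have hu'' := hu'.deriv_of_isOpen (m := ∞) hI le_rfl
  exact ⟨_, _,
    fun t ht => ((hu.differentiableOn (by simp)).differentiableAt (hI.mem_nhds ht)).hasDerivAt,
    fun t ht => ((hu'.differentiableOn (by simp)).differentiableAt (hI.mem_nhds ht)).hasDerivAt,
    hu''.continuousOn⟩

theorem deriv_eq_zero_of_eqOn_const {g g' : ℝ → ℝ} {I : Set ℝ} (hI : IsOpen I)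
    (hg : ∀ t ∈ I, HasDerivAt g (g' t) t) {a : ℝ} (h : ∀ t ∈ I, g t = a) : ∀ t ∈ I, g' t = 0 :=
  fun t ht => (hg t ht).unique ((hasDerivAt_const t a).congr_of_eventuallyEq
    (Filter.mem_of_superset (hI.mem_nhds ht) h))

theorem isConstOn_iff_deriv_inv_eq_zero {f u' : ℝ → ℝ} {I : Set ℝ} (hI : IsOpenInterval I)
    (hf0 : ∀ t ∈ I, f t ≠ 0) (hu : ∀ t ∈ I, HasDerivAt (fun t => (f t)⁻¹) (u' t) t) :
    IsConstOn f I ↔ ∀ t ∈ I, u' t = 0 := by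
  constructor
  · rintro ⟨k, -, hk⟩
    exact deriv_eq_zero_of_eqOn_const hI.1 hu (a := k⁻¹) fun t ht => by rw [hk t ht]
  · intro h
    obtain ⟨c, hc⟩ := exists_eq_affine_of_hasDerivAt hI.1 hI.2.1.isPreconnected (a := 0)
      fun t ht => h t ht ▸ hu t ht
    obtain ⟨t₀, ht₀⟩ := hI.2.2
    refine ⟨f t₀, hf0 t₀ ht₀, fun t ht => inv_injective ?_⟩
    rw [hc t ht, hc t₀ ht₀]
    ring

theorem isConstOn_or_isReciprocalOn_iff {f u' u'' : ℝ → ℝ} {I : Set ℝ} (hI : IsOpenInterval I)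
    (hf0 : ∀ t ∈ I, f t ≠ 0) (hu : ∀ t ∈ I, HasDerivAt (fun t => (f t)⁻¹) (u' t) t)
    (hu' : ∀ t ∈ I, HasDerivAt u' (u'' t) t) :
    IsConstOn f I ∨ IsReciprocalOn f I ↔ ∀ t ∈ I, u'' t = 0 := by
  constructor
  · rintro (h | ⟨k, c, hk, hc, h⟩)
    · exact deriv_eq_zero_of_eqOn_const hI.1 hu' ((isConstOn_iff_deriv_inv_eq_zero hI hf0 hu).1 h)
    · refine deriv_eq_zero_of_eqOn_const hI.1 hu' (a := 1 / k) fun t ht => (hu t ht).unique ?_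
      refine (((hasDerivAt_id t).sub_const c).div_const k).congr_of_eventuallyEq
        (Filter.mem_of_superset (hI.1.mem_nhds ht) fun y hy => ?_)
      simp [h y hy]
  · intro h
    obtain ⟨a, ha⟩ := exists_eq_affine_of_hasDerivAt hI.1 hI.2.1.isPreconnected (a := 0)
      fun t ht => h t ht ▸ hu' t ht
    simp only [zero_mul, zero_add] at ha
    by_cases ha0 : a = 0
    · exact Or.inl ((isConstOn_iff_deriv_inv_eq_zero hI hf0 hu).2 fun t ht => (ha t ht).trans ha0)
    · obtain ⟨c, hc⟩ := exists_eq_affine_of_hasDerivAt hI.1 hI.2.1.isPreconnected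
        fun t ht => ha t ht ▸ hu t ht
      -- Here 1/f = at + c; its zero -c/a lies outside I because 1/f never vanishes there.
      refine Or.inr ⟨a⁻¹, -c / a, inv_ne_zero ha0, fun hmem => ?_, fun t ht => inv_injective ?_⟩
      · refine inv_ne_zero (hf0 _ hmem) ((hc _ hmem).trans ?_)
        field_simp
        ring
      · rw [hc t ht, inv_div, div_inv_eq_mul]
        field_simp
        ring

end Classification

end DiagonalMetric

open DiagonalMetric in
theorem theorem2p8 (I₁ I₂ I₃ : Set ℝ)
    (hI₁ : DiagonalMetric.IsOpenInterval I₁) (hI₂ : DiagonalMetric.IsOpenInterval I₂)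
    (hI₃ : DiagonalMetric.IsOpenInterval I₃) (f₁ f₂ f₃ : ℝ → ℝ)
    (hf₁ : ContDiffOn ℝ ∞ f₁ I₃) (hf₂ : ContDiffOn ℝ ∞ f₂ I₃) (hf₃ : ContDiffOn ℝ ∞ f₃ I₁)
    (hf₁0 : ∀ t ∈ I₃, f₁ t ≠ 0) (hf₂0 : ∀ t ∈ I₃, f₂ t ≠ 0) (hf₃0 : ∀ t ∈ I₁, f₃ t ≠ 0) :
    DiagonalMetric.IsFlatOn
        (DiagonalMetric.diagMetric ![fun x => f₁ (x 2), fun x => f₂ (x 2), fun x => f₃ (x 0)])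
        (DiagonalMetric.box I₁ I₂ I₃) ↔
      (DiagonalMetric.IsConstOn f₁ I₃ ∧ DiagonalMetric.IsConstOn f₂ I₃ ∧
        DiagonalMetric.IsConstOn f₃ I₁) ∨
      (DiagonalMetric.IsReciprocalOn f₁ I₃ ∧ DiagonalMetric.IsConstOn f₂ I₃ ∧
        DiagonalMetric.IsConstOn f₃ I₁) ∨
      (DiagonalMetric.IsConstOn f₁ I₃ ∧ DiagonalMetric.IsReciprocalOn f₂ I₃ ∧
        DiagonalMetric.IsConstOn f₃ I₁) ∨
      (DiagonalMetric.IsConstOn f₁ I₃ ∧ DiagonalMetric.IsConstOn f₂ I₃ ∧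
        DiagonalMetric.IsReciprocalOn f₃ I₁) ∨
      (DiagonalMetric.IsReciprocalOn f₁ I₃ ∧ DiagonalMetric.IsConstOn f₂ I₃ ∧
        DiagonalMetric.IsReciprocalOn f₃ I₁) ∨
      (∃ k₁ k₃ : ℝ, k₁ ≠ 0 ∧ k₃ = -k₁ ∧ DiagonalMetric.IsLogForm k₁ I₃ f₁ ∧
        DiagonalMetric.IsLogForm k₃ I₁ f₃ ∧ DiagonalMetric.IsConstOn f₂ I₃) := by
  obtain ⟨u', u'', hu, hu', hcu⟩ := exists_hasDerivAt_inv hI₃.1 hf₁ hf₁0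
  obtain ⟨v', v'', hv, hv', -⟩ := exists_hasDerivAt_inv hI₃.1 hf₂ hf₂0
  obtain ⟨w', w'', hw, hw', hcw⟩ := exists_hasDerivAt_inv hI₁.1 hf₃ hf₃0
  have hu1 := isConstOn_iff_deriv_inv_eq_zero hI₃ hf₁0 hu
  have hv1 := isConstOn_iff_deriv_inv_eq_zero hI₃ hf₂0 hv
  have hw1 := isConstOn_iff_deriv_inv_eq_zero hI₁ hf₃0 hw
  have hu2 := isConstOn_or_isReciprocalOn_iff hI₃ hf₁0 hu hu'
  have hv2 := isConstOn_or_isReciprocalOn_iff hI₃ hf₂0 hv hv'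
  have hw2 := isConstOn_or_isReciprocalOn_iff hI₁ hf₃0 hw hw'
  rw [diagMetric_eq_lameMetric, isFlatOn_lameMetric_iff hI₁.1 hI₂.1 hI₃.1 hI₂.2.2
    hu hu' (fun t ht => inv_ne_zero (hf₁0 t ht)) hv hv' (fun t ht => inv_ne_zero (hf₂0 t ht))
    hw hw' (fun t ht => inv_ne_zero (hf₃0 t ht))]
  constructor
  · intro h
    obtain ⟨s₀, hs₀⟩ := hI₁.2.2
    obtain ⟨t₀, ht₀⟩ := hI₃.2.2
    have hv0 : ∀ t ∈ I₃, v'' t = 0 := fun t ht => (h s₀ hs₀ t ht).1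
    by_cases hvz : ∀ t ∈ I₃, v' t = 0
    · have hc₂ := hv1.2 hvz
      -- The separation constant: a function of x³ plus a function of x¹ vanishes, so each is
      -- constant.
      obtain ⟨k, hk⟩ : ∃ k, (f₁ t₀)⁻¹ * u'' t₀ = -k := ⟨_, (neg_neg _).symm⟩
      have hkw : ∀ s ∈ I₁, (f₃ s)⁻¹ * w'' s = k := fun s hs => by
        linarith [(h s hs t₀ ht₀).2.2.2]
      have hku : ∀ t ∈ I₃, (f₁ t)⁻¹ * u'' t = -k := fun t ht => by
        linarith [(h s₀ hs₀ t ht).2.2.2, hkw s₀ hs₀]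
      by_cases hk0 : k = 0
      · have hc₁ := hu2.2 fun t ht =>
          (mul_eq_zero.1 ((hku t ht).trans (by simp [hk0]))).resolve_left (inv_ne_zero (hf₁0 t ht))
        have hc₃ := hw2.2 fun s hs => (mul_eq_zero.1 ((hkw s hs).trans hk0)).resolve_left
          (inv_ne_zero (hf₃0 s hs))
        rcases hc₁ with h₁ | h₁ <;> rcases hc₃ with h₃ | h₃
        · exact Or.inl ⟨h₁, hc₂, h₃⟩
        · exact Or.inr (Or.inr (Or.inr (Or.inl ⟨h₁, hc₂, h₃⟩)))
        · exact Or.inr (Or.inl ⟨h₁, hc₂, h₃⟩)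
        · exact Or.inr (Or.inr (Or.inr (Or.inr (Or.inl ⟨h₁, hc₂, h₃⟩))))
      · have hl₁ := isLogForm_of_mul_deriv_deriv_eq hk0 hI₃.1
          ⟨hI₃.2.2, hI₃.2.1.isPreconnected⟩ hu hu' hf₁0 hku
        have hl₃ := isLogForm_of_mul_deriv_deriv_eq (neg_ne_zero.2 hk0) hI₁.1
          ⟨hI₁.2.2, hI₁.2.1.isPreconnected⟩ hw hw' hf₃0 fun s hs => by rw [hkw s hs, neg_neg]
        exact Or.inr (Or.inr (Or.inr (Or.inr (Or.inr ⟨k, -k, hk0, rfl, hl₁, hl₃, hc₂⟩))))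
    · push Not at hvz
      obtain ⟨t₁, ht₁, hvt₁⟩ := hvz
      obtain ⟨a, ha⟩ := exists_eq_affine_of_hasDerivAt hI₃.1 hI₃.2.1.isPreconnected (a := 0)
        fun t ht => hv0 t ht ▸ hv' t ht
      have hc₃ := hw1.2 fun s hs => (mul_eq_zero.1 (h s hs t₁ ht₁).2.2.1).resolve_left hvt₁
      have hc₁ := hu1.2 fun t ht => (mul_eq_zero.1 (h s₀ hs₀ t ht).2.1).resolve_right (by
        rw [ha t ht, zero_mul]
        rwa [ha t₁ ht₁, zero_mul] at hvt₁)
      have hc₂ := hv2.2 hv0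
      rcases hc₂ with h₂ | h₂
      -- A constant f₂ is impossible with v' ≠ 0, but the first alternative covers it without a
      -- contradiction argument.
      · exact Or.inl ⟨hc₁, h₂, hc₃⟩
      · exact Or.inr (Or.inr (Or.inl ⟨hc₁, h₂, hc₃⟩))
  · have hlin : (IsConstOn f₁ I₃ ∨ IsReciprocalOn f₁ I₃) → IsConstOn f₂ I₃ →
        (IsConstOn f₃ I₁ ∨ IsReciprocalOn f₃ I₁) → ∀ s ∈ I₁, ∀ t ∈ I₃,
        v'' t = 0 ∧ u' t * v' t = 0 ∧ v' t * w' s = 0 ∧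
          (f₁ t)⁻¹ * u'' t + (f₃ s)⁻¹ * w'' s = 0 := by
      intro h₁ h₂ h₃ s hs t ht
      simp [hv2.1 (Or.inl h₂) t ht, hv1.1 h₂ t ht, hu2.1 h₁ t ht, hw2.1 h₃ s hs]
    rintro (⟨h₁, h₂, h₃⟩ | ⟨h₁, h₂, h₃⟩ | ⟨h₁, h₂, h₃⟩ | ⟨h₁, h₂, h₃⟩ | ⟨h₁, h₂, h₃⟩ |
      ⟨k, _, hk, rfl, h₁, h₃, h₂⟩)
    · exact hlin (Or.inl h₁) h₂ (Or.inl h₃)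
    · exact hlin (Or.inr h₁) h₂ (Or.inl h₃)
    · intro s hs t ht
      simp [hv2.1 (Or.inr h₂) t ht, hu1.1 h₁ t ht, hw1.1 h₃ s hs, hu2.1 (Or.inl h₁) t ht,
        hw2.1 (Or.inl h₃) s hs]
    · exact hlin (Or.inl h₁) h₂ (Or.inr h₃)
    · exact hlin (Or.inr h₁) h₂ (Or.inr h₃)
    · intro s hs t ht
      have e₁ := mul_deriv_deriv_eq_of_isLogForm hk hI₃.1 hu hu' hcu h₁ t ht
      have e₃ := mul_deriv_deriv_eq_of_isLogForm (neg_ne_zero.2 hk) hI₁.1 hw hw' hcw h₃ s hs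
      simp [hv2.1 (Or.inl h₂) t ht, hv1.1 h₂ t ht, e₁, e₃]
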